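/- Let $\mathbb F_q$ be a finite field with $q$ elements and let $n$ be a positive integer with $\gcd(n,q)=1$. Let $\operatorname{rad}(n)$ be the product of the distinct primes dividing $n$, and let $w$ be the multiplicative order of $q$ modulo $\operatorname{rad}(n)$. Put $s=w$ if $4\nmid n$ or $q^w\equiv 1\pmod 4$, and $s=2w$ otherwise. For every positive integer $t$ put $d^{(t)}=\gcd(n,q^t-1)$. Let $\zeta$ be a primitive $d^{(s)}$-th root of unity in an extension field of $\mathbb F_q$, and let $I$ be a complete set of non-negative integers representing the $q$-cyclotomic cosets $\{i q^j \bmod d^{(s)} : j\ge 0\}$ modulo $d^{(s)}$ (every coset is the coset of exactly one element of $I$). For $i\in I$ let $$c_i=\min\Bigl\{t\in\mathbb Z_{>0} : \tfrac{d^{(s)}}{d^{(t)}}\ \text{divides}\ i\Bigr\},$$ where a rational number $r$ is said to divide $i$ if $i$ is an integral multiple of $r$. Then the factorization of $X^n-1$ into monic irreducible polynomials over $\mathbb F_q$ is $$X^n-1=\prod_{v\mid n/d^{(s)}}\ \prod_{\substack{i\in I\\ \gcd(i,v)=1}} S_{v,i},$$ $$S_{v,i}=\sum_{l=0}^{c_i}X^{vl}(-1)^{c_i-l}\sum_{\substack{U\subseteq\{0,\dots,c_i-1\}\\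 |U|=c_i-l}}\ \prod_{u\in U}\zeta^{iq^u}=\prod_{u=0}^{c_i-1}\bigl(X^v-\zeta^{iq^u}\bigr).$$ That is, for all such $v$ and $i$, the polynomial $S_{v,i}$ has its coefficients in $\mathbb F_q$ and is monic and irreducible over $\mathbb F_q$. It has degree $v\,c_i$, and its order (the least positive integer $e$ with $S_{v,i}\mid X^e-1$) is $v\cdot d^{(s)}/\gcd(i,d^{(s)})$. -/

import Mathlib

open Polynomial

/-- The multiplicative order `w` of `q` modulo the radical of `n`. -/
noncomputable def ordRad (q n : ℕ) : ℕ :=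
  orderOf (q : ZMod (UniqueFactorizationMonoid.radical n))

/-- `s = w` if `4 ∤ n` or `q ^ w ≡ 1 (mod 4)`, and `s = 2 w` otherwise. -/
noncomputable def extDeg (q n : ℕ) : ℕ :=
  if ¬ 4 ∣ n ∨ q ^ ordRad q n ≡ 1 [MOD 4] then ordRad q n else 2 * ordRad q n

/-- `d^{(t)} = gcd(n, q^t - 1)`. -/
def dGcd (q n t : ℕ) : ℕ := Nat.gcd n (q ^ t - 1)

/-- `c_i`, the least positive integer `t` such that `d^{(s)} / d^{(t)}` divides `i`.
The quotient is taken in `ℚ` (it need not be an integer for every `t`), and divisibility means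
that `i` is an integral multiple of it. -/
noncomputable def coeffDeg (q n i : ℕ) : ℕ :=
  sInf {t : ℕ | 0 < t ∧
    ∃ k : ℕ, (i : ℚ) = (dGcd q n (extDeg q n) : ℚ) / (dGcd q n t : ℚ) * k}

/-- The `q`-cyclotomic coset `{i q^j mod d : j ≥ 0}` of `i` modulo `d`. -/
def cyclotomicCoset (q d i : ℕ) : Set ℕ := {m | ∃ j : ℕ, m = i * q ^ j % d}

/-- `I` is a complete set of representatives of the `q`-cyclotomic cosets modulo `d`:
every coset is the coset of exactly one element of `I`. -/
def IsCosetRepSystem (q d : ℕ) (I : Finset ℕ) : Prop :=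
  ∀ a : ℕ, ∃! i : ℕ, i ∈ I ∧ cyclotomicCoset q d i = cyclotomicCoset q d a

/-- The order of a polynomial `f`: the least positive integer `e` with `f ∣ X^e - 1`. -/
noncomputable def polyOrder {F : Type*} [Field F] (f : F[X]) : ℕ :=
  sInf {e : ℕ | 0 < e ∧ f ∣ X ^ e - 1}

/-- The closed formula
`∑_{l=0}^{c} X^{v l} (-1)^{c-l} ∑_{U ⊆ {0,…,c-1}, |U| = c-l} ∏_{u ∈ U} ζ^{i q^u}`. -/
noncomputable def closedFactor {K : Type*} [Field K] (q : ℕ) (ζ : K) (c v i : ℕ) : K[X] :=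
  ∑ l ∈ Finset.range (c + 1), X ^ (v * l) * ((-1) ^ (c - l) *
    C (∑ U ∈ (Finset.range c).powersetCard (c - l), ∏ u ∈ U, ζ ^ (i * q ^ u)))

/-!
The factor `S_{v,i}` is the minimal polynomial of `ζ ^ i` evaluated at `X ^ v`. Let `a` be one of
its roots, so that `a ^ v` is conjugate to `ζ ^ i`. Since `rad n ∣ d` and `gcd (i, v) = 1`, every
prime divisor of `v` divides `e = ord (ζ ^ i)`, hence `a` has order `v e`. The degree `m` of `a`
over `F` is the multiplicative order of `q` modulo `v e`, while the degree `c` of `ζ ^ i` is the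
order modulo `e`. No prime divisor `p` of `v` satisfies `p e ∣ q ^ c - 1`, because `v ∣ n / d`,
`d = gcd (n, q ^ s - 1)` and `c ∣ s`. So lifting the exponent turns `v e ∣ q ^ m - 1` into
`v c ∣ m`, and `S_{v,i}` is the minimal polynomial of `a`.

The order `v e` and `gcd (v e, d) = e` determine `v`, and then `i` is determined because conjugacy
of powers of `ζ` is equality of cyclotomic cosets. Conversely, if `a ^ n = 1`, then with
`v = ord a / gcd (ord a, d)` the power `a ^ v` is a `d`-th root of unity, hence conjugate to some
`ζ ^ i`, and `a` is a root of `S_{v,i}`. Since `X ^ n - 1` is separable, it is the product of the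
`S_{v,i}`.
-/

section Divisibility

theorem emultiplicity_pow_sub_one {p Q : ℕ} (hp : p.Prime) (hQ : 0 < Q) (hpQ : p ∣ Q - 1)
    (hfour : p = 2 → 4 ∣ Q - 1) (k : ℕ) :
    emultiplicity p (Q ^ k - 1) = emultiplicity p (Q - 1) + emultiplicity p k := by
  have hndvd : ¬ p ∣ Q := fun h ↦ hp.not_dvd_one ((Nat.dvd_sub_iff_right hQ h).1 hpQ)
  rcases hp.eq_two_or_odd' with rfl | hodd
  · have h := Int.two_pow_sub_pow' (x := Q) (y := 1) k (by have := hfour rfl; omega) (by omega)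
    rw [one_pow, ← Nat.cast_pow, ← Nat.cast_pred (Nat.pow_pos hQ), ← Nat.cast_pred hQ] at h
    exact_mod_cast h
  · simpa only [one_pow] using Nat.emultiplicity_pow_sub_pow hp hodd hpQ hndvd k

theorem even_of_four_dvd_pow_sub_one {Q k : ℕ} (hQ : ¬ 4 ∣ Q - 1) (h : 4 ∣ Q ^ k - 1) :
    Even k := by
  by_contra hk
  obtain ⟨m, rfl⟩ := Nat.not_even_iff_odd.1 hk
  have hpos : 0 < Q ^ (2 * m + 1) := Nat.pow_pos (by omega)
  rcases Nat.even_or_odd Q with hQe | hQo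
  · have h2 : 2 ∣ Q ^ (2 * m + 1) := hQe.two_dvd.pow (by omega)
    omega
  · have hsq : Q ^ (2 * m) ≡ 1 [MOD 4] := by
      have := Nat.eight_dvd_sq_sub_one_of_odd (hQo.pow (n := m))
      have hpos' : 0 < (Q ^ m) ^ 2 := (hQo.pow.pow (n := 2)).pos
      rw [mul_comm 2 m, pow_mul, Nat.ModEq]
      omega
    have hmod : Q ^ (2 * m + 1) ≡ Q [MOD 4] := by
      simpa only [pow_succ, one_mul] using hsq.mul_right Q
    rw [Nat.ModEq] at hmod
    omega

theorem dvd_of_mul_dvd_pow_sub_one {Q v e k : ℕ} (hQ : 0 < Q) (he : e ≠ 0) (heQ : e ∣ Q - 1)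
    (hprime : ∀ p, p.Prime → p ∣ v → p ∣ e ∧ ¬ p * e ∣ Q - 1) (hfour : 4 ∣ v → 4 ∣ Q - 1)
    (h : v * e ∣ Q ^ k - 1) : v ∣ k := by
  refine (Nat.dvd_iff_prime_pow_dvd_dvd k v).2 fun p j hp ↦ ?_
  revert j
  rw [← emultiplicity_le_emultiplicity_iff]
  by_cases hpv : p ∣ v
  swap
  · simp only [emultiplicity_eq_zero.2 hpv, zero_le]
  obtain ⟨hpe, hpeQ⟩ := hprime p hp hpv
  by_cases hlift : p = 2 → 4 ∣ Q - 1
  · have hval : emultiplicity p (Q - 1) = emultiplicity p e := by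
      obtain ⟨m, hm⟩ := heQ
      have hpm : ¬ p ∣ m := fun hpm ↦ hpeQ (hm ▸ mul_comm p e ▸ mul_dvd_mul_left e hpm)
      rw [hm, emultiplicity_mul hp.prime, emultiplicity_eq_zero.2 hpm, add_zero]
    have hle := emultiplicity_le_emultiplicity_of_dvd_right (a := p) h
    rw [emultiplicity_pow_sub_one hp hQ (hpe.trans heQ) hlift, hval, emultiplicity_mul hp.prime,
      add_comm] at hle
    have hfin : FiniteMultiplicity p e := Nat.finiteMultiplicity_iff.2 ⟨hp.ne_one, he.bot_lt⟩
    exact (ENat.add_le_add_iff_left (finiteMultiplicity_iff_emultiplicity_ne_top.1 hfin)).1 hle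
  -- Lifting the exponent fails for `p = 2` when `4 ∤ Q - 1`; then `4 ∤ v`, and `2 ∣ k` suffices.
  · obtain ⟨rfl, h4⟩ := Classical.not_imp.1 hlift
    have hk : 2 ∣ k := (even_of_four_dvd_pow_sub_one h4 ((mul_dvd_mul hpv hpe).trans h)).two_dvd
    have hv : emultiplicity 2 v = 1 := emultiplicity_eq_coe.2
      ⟨by simpa only [pow_one] using hpv, fun h ↦ h4 (hfour h)⟩
    exact hv ▸ pow_dvd_iff_le_emultiplicity.1 (by simpa only [pow_one] using hk)

theorem orderOf_eq_mul_orderOf_pow {G : Type*} [Monoid G] {a : G} {v : ℕ} (hv : 0 < v)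
    (h : ∀ p, p.Prime → p ∣ v → p ∣ orderOf (a ^ v)) : orderOf a = v * orderOf (a ^ v) := by
  have hpow := orderOf_pow' a hv.ne'
  have hcop := Nat.coprime_div_gcd_div_gcd (Nat.gcd_pos_of_pos_right (orderOf a) hv)
  rw [← hpow] at hcop
  have hone : v / (orderOf a).gcd v = 1 := by
    refine Nat.eq_one_iff_not_exists_prime_dvd.2 fun p hp hpv ↦ hp.not_dvd_one ?_
    exact hcop ▸ Nat.dvd_gcd
      (h p hp (hpv.trans (Nat.div_dvd_of_dvd (Nat.gcd_dvd_right _ _)))) hpv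
  have hdvd : v ∣ orderOf a := by
    have hgcd := Nat.eq_of_dvd_of_div_eq_one (Nat.gcd_dvd_right _ _) hone
    exact hgcd ▸ Nat.gcd_dvd_left _ _
  rw [hpow, Nat.gcd_eq_right hdvd, Nat.mul_div_cancel' hdvd]

theorem dvd_div_gcd_of_coprime {m d i : ℕ} (hmd : m ∣ d) (hmi : m.Coprime i) :
    m ∣ d / i.gcd d :=
  (hmi.coprime_dvd_right (Nat.gcd_dvd_left i d)).dvd_of_dvd_mul_right
    ((Nat.div_mul_cancel (Nat.gcd_dvd_right i d)).symm ▸ hmd)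

theorem gcd_mul_div_gcd {d v i : ℕ} (hiv : i.Coprime v) :
    (v * (d / i.gcd d)).gcd d = d / i.gcd d := by
  have hcop : v.Coprime (i.gcd d) := hiv.symm.coprime_dvd_right (Nat.gcd_dvd_left i d)
  conv_lhs => arg 2; rw [← Nat.mul_div_cancel' (Nat.gcd_dvd_right i d)]
  rw [Nat.gcd_mul_right, hcop, one_mul]

theorem div_gcd_dvd_div {m d n : ℕ} (hmn : m ∣ n) (hdn : d ∣ n) : m / m.gcd d ∣ n / d := by
  rcases Nat.eq_zero_or_pos d with rfl | hd
  · simp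
  have hg := Nat.gcd_pos_of_pos_right m hd
  have hcop := Nat.coprime_div_gcd_div_gcd hg
  refine hcop.dvd_of_dvd_mul_left (Nat.dvd_of_mul_dvd_mul_left hg ?_)
  rwa [Nat.mul_div_cancel' (Nat.gcd_dvd_left m d), ← mul_assoc,
    Nat.mul_div_cancel' (Nat.gcd_dvd_right m d), Nat.mul_div_cancel' hdn]

theorem not_mul_div_gcd_dvd {n N v i p : ℕ} (hn : 0 < n) (hp : p.Prime)
    (hv : v ∣ n / n.gcd N) (hpv : p ∣ v) (hiv : i.Coprime v) :
    ¬ p * (n.gcd N / i.gcd (n.gcd N)) ∣ N := by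
  intro hpe
  set d := n.gcd N
  have hd0 : 0 < d := Nat.gcd_pos_of_pos_left N hn
  have hcop : p.Coprime (i.gcd d) := hiv.symm.coprime_dvd_left hpv |>.coprime_dvd_right
    (Nat.gcd_dvd_left i d)
  have hde : d / i.gcd d * i.gcd d = d := Nat.div_mul_cancel (Nat.gcd_dvd_right i d)
  have hpdN : p * d ∣ N := by
    have he0 : 0 < d / i.gcd d := Nat.pos_of_mul_pos_right (hde.symm ▸ hd0)
    obtain ⟨M, hM⟩ := (dvd_mul_left _ _).trans hpe
    have hgM : i.gcd d ∣ M := Nat.dvd_of_mul_dvd_mul_left he0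
      (hde.symm ▸ hM ▸ Nat.gcd_dvd_right n N)
    have hpM : p ∣ M := Nat.dvd_of_mul_dvd_mul_left he0 (hM ▸ mul_comm p _ ▸ hpe)
    rw [hM]
    nth_rw 1 [← hde]
    rw [mul_left_comm]
    exact mul_dvd_mul_left _ (hcop.mul_dvd_of_dvd_of_dvd hpM hgM)
  have hpdn : p * d ∣ n :=
    mul_comm d p ▸ Nat.mul_dvd_of_dvd_div (Nat.gcd_dvd_left n N) (hpv.trans hv)
  exact hp.not_dvd_one (Nat.dvd_of_mul_dvd_mul_right hd0
    ((one_mul d).symm ▸ Nat.dvd_gcd hpdn hpdN))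

theorem coprime_of_coprime_gcd {v d i : ℕ} (h : ∀ p, p.Prime → p ∣ v → p ∣ d)
    (hv : v.Coprime (i.gcd d)) : v.Coprime i :=
  Nat.coprime_of_dvd fun p hp hpv hpi ↦
    hp.not_dvd_one (hv ▸ Nat.dvd_gcd hpv (Nat.dvd_gcd hpi (h p hp hpv)))

end Divisibility

section FiniteField

variable {F L : Type*} [Field F] [Field L] [Algebra F L]

theorem isIntegral_of_isOfFinOrder {a : L} (ha : IsOfFinOrder a) : IsIntegral F a :=
  .of_pow ha.orderOf_pos (pow_orderOf_eq_one a ▸ isIntegral_one)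

theorem polyOrder_minpoly {a : L} (ha : IsOfFinOrder a) : polyOrder (minpoly F a) = orderOf a := by
  have hdvd (e : ℕ) : minpoly F a ∣ X ^ e - 1 ↔ orderOf a ∣ e := by
    rw [minpoly.dvd_iff, orderOf_dvd_iff_pow_eq_one]
    simp [sub_eq_zero]
  have hleast : IsLeast {e | 0 < e ∧ minpoly F a ∣ X ^ e - 1} (orderOf a) := by
    simp only [hdvd]
    exact ⟨⟨ha.orderOf_pos, dvd_rfl⟩, fun e he ↦ Nat.le_of_dvd he.1 he.2⟩
  exact hleast.csInf_eq

theorem expand_minpoly_eq_minpoly {a : L} {v : ℕ} (hv : 0 < v) (ha : IsIntegral F (a ^ v))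
    (hdeg : v * (minpoly F (a ^ v)).natDegree ∣ (minpoly F a).natDegree) :
    expand F v (minpoly F (a ^ v)) = minpoly F a := by
  have ha' : IsIntegral F a := ha.of_pow hv
  refine eq_of_monic_of_dvd_of_natDegree_le (minpoly.monic ha') ((minpoly.monic ha).expand hv)
    (minpoly.dvd _ _ ?_) ?_
  · rw [expand_aeval, minpoly.aeval]
  · rw [natDegree_expand, mul_comm]
    exact Nat.le_of_dvd (minpoly.natDegree_pos ha') hdeg

variable [Fintype F]

theorem natDegree_minpoly_dvd_iff {a : L} (ha : IsIntegral F a) (c : ℕ) :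
    (minpoly F a).natDegree ∣ c ↔ a ^ Fintype.card F ^ c = a := by
  rw [(minpoly.irreducible ha).natDegree_dvd_iff_dvd_X_pow_card_pow_sub_X, minpoly.dvd_iff,
    Nat.card_eq_fintype_card]
  simp [sub_eq_zero]

theorem natDegree_minpoly_dvd_iff_orderOf_dvd {a : L} (ha : IsOfFinOrder a) (c : ℕ) :
    (minpoly F a).natDegree ∣ c ↔ orderOf a ∣ Fintype.card F ^ c - 1 := by
  rw [natDegree_minpoly_dvd_iff (isIntegral_of_isOfFinOrder ha), orderOf_dvd_iff_pow_eq_one,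
    ← mul_eq_right₀ ha.isUnit.ne_zero, ← pow_succ,
    Nat.sub_add_cancel (Nat.one_le_pow c _ Fintype.card_pos)]

theorem minimalPeriod_pow_card {a : L} (ha : IsIntegral F a) :
    Function.minimalPeriod (· ^ Fintype.card F) a = (minpoly F a).natDegree := by
  refine Nat.dvd_right_iff_eq.1 fun c ↦ ?_
  rw [natDegree_minpoly_dvd_iff ha, ← Function.isPeriodicPt_iff_minimalPeriod_dvd,
    Function.IsPeriodicPt, Function.IsFixedPt, pow_iterate]

theorem isConjRoot_pow_card_pow (a : L) (u : ℕ) : IsConjRoot F a (a ^ Fintype.card F ^ u) := by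
  have h : (FiniteField.frobeniusAlgHom F L ^ u) a = a ^ Fintype.card F ^ u := by
    rw [AlgHom.coe_pow, FiniteField.coe_frobeniusAlgHom, pow_iterate]
  rw [← h]
  exact (minpoly.algHom_eq _ (RingHom.injective _) a).symm

theorem map_minpoly_eq_prod {a : L} (ha : IsIntegral F a) :
    (minpoly F a).map (algebraMap F L) =
      ∏ u ∈ Finset.range (minpoly F a).natDegree, (X - C (a ^ Fintype.card F ^ u)) := by
  have hinj : Set.InjOn (fun u ↦ a ^ Fintype.card F ^ u)
      (Finset.range (minpoly F a).natDegree : Set ℕ) := by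
    have := Function.iterate_injOn_Iio_minimalPeriod (f := (· ^ Fintype.card F)) (x := a)
    simpa only [pow_iterate, minimalPeriod_pow_card ha, Finset.coe_range] using this
  refine eq_of_monic_of_dvd_of_natDegree_le (monic_prod_X_sub_C _ _)
    ((minpoly.monic ha).map _) (Finset.prod_dvd_of_coprime ?_ fun u _ ↦ ?_) ?_
  · exact fun u hu v hv huv ↦
      isCoprime_X_sub_C_of_isUnit_sub (sub_ne_zero.2 (hinj.ne hu hv huv)).isUnit
  · rw [dvd_iff_isRoot, IsRoot, eval_map_algebraMap]
    exact (isConjRoot_pow_card_pow a u).aeval_eq_zero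
  · rw [natDegree_map, natDegree_finsetProd_X_sub_C_eq_card, Finset.card_range]

theorem isConjRoot_iff_exists_pow_card_pow {a b : L} (ha : IsIntegral F a) :
    IsConjRoot F a b ↔ ∃ u, b = a ^ Fintype.card F ^ u := by
  refine ⟨fun h ↦ ?_, fun ⟨u, hu⟩ ↦ hu ▸ isConjRoot_pow_card_pow a u⟩
  have hb := h.aeval_eq_zero
  rw [← eval_map_algebraMap, map_minpoly_eq_prod ha, eval_prod, Finset.prod_eq_zero_iff] at hb
  obtain ⟨u, -, hu⟩ := hb
  exact ⟨u, by simpa [sub_eq_zero] using hu⟩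

theorem map_expand_minpoly {a : L} (ha : IsIntegral F a) (v : ℕ) :
    (expand F v (minpoly F a)).map (algebraMap F L) =
      ∏ u ∈ Finset.range (minpoly F a).natDegree, (X ^ v - C (a ^ Fintype.card F ^ u)) := by
  rw [map_expand, map_minpoly_eq_prod ha, map_prod]
  simp only [map_sub, expand_X, expand_C]

theorem expand_minpoly_pow_eq_minpoly {a : L} (ha : IsOfFinOrder a) {v : ℕ} (hv : 0 < v)
    (hprime : ∀ p, p.Prime → p ∣ v → p ∣ orderOf (a ^ v) ∧
      ¬ p * orderOf (a ^ v) ∣ Fintype.card F ^ (minpoly F (a ^ v)).natDegree - 1)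
    (hfour : 4 ∣ v → 4 ∣ Fintype.card F ^ (minpoly F (a ^ v)).natDegree - 1) :
    expand F v (minpoly F (a ^ v)) = minpoly F a := by
  refine expand_minpoly_eq_minpoly hv (isIntegral_of_isOfFinOrder ha.pow) ?_
  have hdvd := (natDegree_minpoly_dvd_iff_orderOf_dvd (F := F) ha _).1 dvd_rfl
  rw [orderOf_eq_mul_orderOf_pow hv fun p hp hpv ↦ (hprime p hp hpv).1] at hdvd
  obtain ⟨k, hk⟩ : (minpoly F (a ^ v)).natDegree ∣ (minpoly F a).natDegree :=
    (natDegree_minpoly_dvd_iff_orderOf_dvd ha.pow _).2 ((dvd_mul_left _ _).trans hdvd)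
  rw [hk, pow_mul] at hdvd
  rw [hk, mul_comm v]
  exact mul_dvd_mul_left _ (dvd_of_mul_dvd_pow_sub_one (Nat.pow_pos Fintype.card_pos)
    ha.pow.orderOf_pos.ne' ((natDegree_minpoly_dvd_iff_orderOf_dvd ha.pow _).1 dvd_rfl)
    hprime hfour hdvd)

theorem exists_expand_minpoly_eq_minpoly {b : L} (hb : IsOfFinOrder b) {v : ℕ} (hv : 0 < v)
    (hprime : ∀ p, p.Prime → p ∣ v →
      p ∣ orderOf b ∧ ¬ p * orderOf b ∣ Fintype.card F ^ (minpoly F b).natDegree - 1)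
    (hfour : 4 ∣ v → 4 ∣ Fintype.card F ^ (minpoly F b).natDegree - 1) :
    ∃ a : AlgebraicClosure L, orderOf a = v * orderOf b ∧
      expand F v (minpoly F b) = minpoly F a := by
  obtain ⟨a, ha⟩ := IsAlgClosed.exists_pow_nat_eq (algebraMap L (AlgebraicClosure L) b) hv
  have hinj := (algebraMap L (AlgebraicClosure L)).injective
  have hord : orderOf (a ^ v) = orderOf b :=
    ha ▸ orderOf_injective (algebraMap L (AlgebraicClosure L)).toMonoidHom hinj b
  have hmin : minpoly F (a ^ v) = minpoly F b := ha ▸ minpoly.algebraMap_eq hinj b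
  have hafin : IsOfFinOrder a :=
    (orderOf_pos_iff.1 (hord ▸ hb.orderOf_pos)).of_pow hv.ne'
  rw [← hord, ← hmin] at hprime ⊢
  rw [← hmin] at hfour
  exact ⟨a, orderOf_eq_mul_orderOf_pow hv fun p hp hpv ↦ (hprime p hp hpv).1,
    expand_minpoly_pow_eq_minpoly hafin hv hprime hfour⟩

end FiniteField

theorem closedFactor_eq_prod {K : Type*} [Field K] (q : ℕ) (ζ : K) (c v i : ℕ) :
    closedFactor q ζ c v i = ∏ u ∈ Finset.range c, (X ^ v - C (ζ ^ (i * q ^ u))) := by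
  rw [Finset.prod_sub, Finset.sum_powerset, Finset.card_range, ← Finset.sum_range_reflect,
    closedFactor]
  refine Finset.sum_congr rfl fun l hl ↦ ?_
  have hl : l ≤ c := Nat.lt_succ_iff.1 (Finset.mem_range.1 hl)
  rw [Nat.add_sub_cancel, map_sum, Finset.mul_sum, Finset.mul_sum]
  refine Finset.sum_congr rfl fun U hU ↦ ?_
  obtain ⟨hU, hcard⟩ := Finset.mem_powersetCard.1 hU
  rw [hcard, Finset.prod_const, Finset.card_sdiff_of_subset hU, Finset.card_range, hcard,
    Nat.sub_sub_self hl, ← pow_mul, map_prod]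
  ring

theorem eq_prod_of_forall_irreducible_dvd {F ι : Type*} [Field F] {P : F[X]} (hP : P.Monic)
    (hsq : Squarefree P) {s : Finset ι} {f : ι → F[X]} (hinj : Set.InjOn f s)
    (hf : ∀ x ∈ s, (f x).Monic ∧ Irreducible (f x) ∧ f x ∣ P)
    (hcover : ∀ g, g.Monic → Irreducible g → g ∣ P → ∃ x ∈ s, f x = g) : P = ∏ x ∈ s, f x := by
  classical
  have hfactors : UniqueFactorizationMonoid.normalizedFactors P = s.val.map f := by
    refine (Multiset.Nodup.ext
      ((UniqueFactorizationMonoid.squarefree_iff_nodup_normalizedFactors hP.ne_zero).1 hsq)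
      (s.nodup.map_on fun x hx y hy h ↦ hinj hx hy h)).2 fun g ↦ ?_
    rw [Polynomial.mem_normalizedFactors_iff hP.ne_zero, Multiset.mem_map]
    constructor
    · rintro ⟨hirr, hmonic, hdvd⟩
      exact hcover g hmonic hirr hdvd
    · rintro ⟨x, hx, rfl⟩
      obtain ⟨hmonic, hirr, hdvd⟩ := hf x hx
      exact ⟨hirr, hmonic, hdvd⟩
  have h := leadingCoeff_mul_prod_normalizedFactors P
  rw [hP.leadingCoeff, C_1, one_mul, hfactors] at h
  exact h.symm

theorem orderOf_pow_of_isPrimitiveRoot {M : Type*} [CommMonoid M] {ζ : M} {d : ℕ} (hd : 0 < d)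
    (hζ : IsPrimitiveRoot ζ d) (i : ℕ) : orderOf (ζ ^ i) = d / i.gcd d := by
  rw [(hζ.isOfFinOrder hd.ne').orderOf_pow, ← hζ.eq_orderOf, Nat.gcd_comm]

section Coset

variable {F L : Type*} [Field F] [Fintype F] [Field L] [Algebra F L] {ζ : L} {d i j : ℕ}

theorem isConjRoot_pow_iff_exists_modEq (hd : 0 < d) (hζ : IsPrimitiveRoot ζ d) :
    IsConjRoot F (ζ ^ i) (ζ ^ j) ↔ ∃ u, j ≡ i * Fintype.card F ^ u [MOD d] := by
  have hfin := hζ.isOfFinOrder hd.ne'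
  simp only [isConjRoot_iff_exists_pow_card_pow (isIntegral_of_isOfFinOrder hfin.pow), ← pow_mul,
    hfin.pow_eq_pow_iff_modEq, ← hζ.eq_orderOf]

theorem cyclotomicCoset_eq_iff_isConjRoot (hd : 0 < d) (hζ : IsPrimitiveRoot ζ d) :
    cyclotomicCoset (Fintype.card F) d i = cyclotomicCoset (Fintype.card F) d j ↔
      IsConjRoot F (ζ ^ i) (ζ ^ j) := by
  have hsubset {i j : ℕ} (h : IsConjRoot F (ζ ^ i) (ζ ^ j)) :
      cyclotomicCoset (Fintype.card F) d j ⊆ cyclotomicCoset (Fintype.card F) d i := by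
    obtain ⟨u, hu⟩ := (isConjRoot_pow_iff_exists_modEq hd hζ).1 h
    rintro _ ⟨k, rfl⟩
    exact ⟨u + k, by rw [pow_add, ← mul_assoc]; exact hu.mul_right _⟩
  refine ⟨fun h ↦ (isConjRoot_pow_iff_exists_modEq hd hζ).2 ?_,
    fun h ↦ (hsubset h.symm).antisymm (hsubset h)⟩
  have hj : j % d ∈ cyclotomicCoset (Fintype.card F) d i := h ▸ ⟨0, by rw [pow_zero, mul_one]⟩
  exact hj

end Coset

/-- The paper's `c_i` for an arbitrary exponent `s`: the least positive `t` such that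
`d^{(s)} / d^{(t)}` divides `i`, so that `coeffDeg q n` is `cosetDeg q n (extDeg q n)`. It is the
size of the `q`-cyclotomic coset of `i` modulo `d^{(s)}`. -/
noncomputable def cosetDeg (q n s i : ℕ) : ℕ :=
  sInf {t : ℕ | 0 < t ∧ ∃ k : ℕ, (i : ℚ) = (dGcd q n s : ℚ) / (dGcd q n t : ℚ) * k}

/-- The conditions on `s` which say, for `n` prime to the prime power `q`, that all irreducible
factors of `X ^ n - 1` over the extension of degree `s > 0` of the field with `q` elements are
binomials. The paper's exponent `extDeg q n` is one such `s`. -/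
structure IsBinomialExponent (q n s : ℕ) : Prop where
  radical_dvd : UniqueFactorizationMonoid.radical n ∣ q ^ s - 1
  four_dvd : 8 ∣ n → 4 ∣ q ^ s - 1

theorem dGcd_pos {q n : ℕ} (hn : 0 < n) (t : ℕ) : 0 < dGcd q n t :=
  Nat.gcd_pos_of_pos_left _ hn

theorem dGcd_dvd (q n t : ℕ) : dGcd q n t ∣ n :=
  Nat.gcd_dvd_left _ _

theorem dvd_of_dvd_div_dGcd {q n v t : ℕ} (hv : v ∣ n / dGcd q n t) : v ∣ n :=
  hv.trans (Nat.div_dvd_of_dvd (dGcd_dvd q n t))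

theorem prime_dvd_dGcd {q n s p : ℕ} (hn : 0 < n)
    (hs : IsBinomialExponent q n s) (hp : p.Prime) (hpn : p ∣ n) :
    p ∣ dGcd q n s := by
  have hrad := (UniqueFactorizationMonoid.dvd_radical_iff_of_irreducible hp hn.ne').2 hpn
  exact Nat.dvd_gcd hpn (hrad.trans hs.radical_dvd)

section Factors

variable {F K : Type*} [Field F] [Fintype F] [Field K] [Algebra F K] {n s : ℕ} {ζ : K}

theorem cosetDeg_eq_natDegree_minpoly (hn : 0 < n)
    (hζ : IsPrimitiveRoot ζ (dGcd (Fintype.card F) n s)) (i : ℕ) :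
    cosetDeg (Fintype.card F) n s i = (minpoly F (ζ ^ i)).natDegree := by
  have hfin : IsOfFinOrder (ζ ^ i) := (hζ.isOfFinOrder (dGcd_pos hn s).ne').pow
  have hiff (t : ℕ) : (∃ k : ℕ, (i : ℚ) =
      (dGcd (Fintype.card F) n s : ℚ) / (dGcd (Fintype.card F) n t : ℚ) * k) ↔
      (minpoly F (ζ ^ i)).natDegree ∣ t := by
    have hdt : (dGcd (Fintype.card F) n t : ℚ) ≠ 0 := Nat.cast_ne_zero.2 (dGcd_pos hn t).ne'
    have hcast (k : ℕ) : (i : ℚ) =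
        (dGcd (Fintype.card F) n s : ℚ) / (dGcd (Fintype.card F) n t : ℚ) * k ↔
        i * dGcd (Fintype.card F) n t = dGcd (Fintype.card F) n s * k := by
      rw [div_mul_eq_mul_div, eq_div_iff hdt]
      exact_mod_cast Iff.rfl
    simp_rw [hcast]
    rw [natDegree_minpoly_dvd_iff_orderOf_dvd hfin, orderOf_dvd_iff_pow_eq_one, ← pow_mul,
      hζ.pow_eq_one_iff_dvd, ← dvd_def, dGcd, dGcd, ← Nat.gcd_mul_left, Nat.dvd_gcd_iff]
    exact and_iff_right ((Nat.gcd_dvd_left _ _).mul_left _)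
  simp_rw [cosetDeg, hiff]
  exact IsLeast.csInf_eq ⟨⟨minpoly.natDegree_pos (isIntegral_of_isOfFinOrder hfin), dvd_rfl⟩,
    fun t ht ↦ Nat.le_of_dvd ht.1 ht.2⟩

theorem exists_expand_minpoly_pow_eq_minpoly (hn : 0 < n)
    (hs : IsBinomialExponent (Fintype.card F) n s)
    (hζ : IsPrimitiveRoot ζ (dGcd (Fintype.card F) n s)) {v i : ℕ}
    (hv : v ∣ n / dGcd (Fintype.card F) n s) (hiv : i.Coprime v) :
    ∃ a : AlgebraicClosure K, IsOfFinOrder a ∧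
      orderOf a = v * (dGcd (Fintype.card F) n s / i.gcd (dGcd (Fintype.card F) n s)) ∧
      expand F v (minpoly F (ζ ^ i)) = minpoly F a := by
  have hd := dGcd_pos (q := Fintype.card F) hn s
  have hvn := dvd_of_dvd_div_dGcd hv
  have hv0 := Nat.pos_of_dvd_of_pos hvn hn
  have hfin : IsOfFinOrder (ζ ^ i) := (hζ.isOfFinOrder hd.ne').pow
  have hord := orderOf_pow_of_isPrimitiveRoot hd hζ i
  have hdvd_orderOf {m : ℕ} (hmd : m ∣ dGcd (Fintype.card F) n s) (hmv : m ∣ v) :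
      m ∣ orderOf (ζ ^ i) := hord ▸ dvd_div_gcd_of_coprime hmd (hiv.symm.coprime_dvd_left hmv)
  have hdeg : (minpoly F (ζ ^ i)).natDegree ∣ s := by
    rw [natDegree_minpoly_dvd_iff_orderOf_dvd hfin, hord]
    exact (Nat.div_dvd_of_dvd (Nat.gcd_dvd_right _ _)).trans (Nat.gcd_dvd_right _ _)
  have hprime (p : ℕ) (hp : p.Prime) (hpv : p ∣ v) : p ∣ orderOf (ζ ^ i) ∧
      ¬ p * orderOf (ζ ^ i) ∣ Fintype.card F ^ (minpoly F (ζ ^ i)).natDegree - 1 := by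
    refine ⟨hdvd_orderOf (prime_dvd_dGcd hn hs hp (hpv.trans hvn)) hpv, fun h ↦ ?_⟩
    exact not_mul_div_gcd_dvd hn hp hv hpv hiv
      ((hord ▸ h).trans (Nat.pow_sub_one_dvd_pow_sub_one _ hdeg))
  have hfour (h4 : 4 ∣ v) : 4 ∣ Fintype.card F ^ (minpoly F (ζ ^ i)).natDegree - 1 := by
    have h2 := prime_dvd_dGcd hn hs Nat.prime_two (Dvd.dvd.trans ⟨2, rfl⟩ (h4.trans hvn))
    have h8 : 8 ∣ n := (mul_dvd_mul (h4.trans hv) h2).trans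
      (Nat.div_mul_cancel (dGcd_dvd _ n s)).dvd
    exact (hdvd_orderOf (Nat.dvd_gcd (h4.trans hvn) (hs.four_dvd h8)) h4).trans
      ((natDegree_minpoly_dvd_iff_orderOf_dvd hfin _).1 dvd_rfl)
  obtain ⟨a, ha, hmin⟩ := exists_expand_minpoly_eq_minpoly hfin hv0 hprime hfour
  exact ⟨a, orderOf_pos_iff.1 (ha ▸ Nat.mul_pos hv0 hfin.orderOf_pos), hord ▸ ha, hmin⟩

theorem irreducible_expand_minpoly_pow (hn : 0 < n)
    (hs : IsBinomialExponent (Fintype.card F) n s)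
    (hζ : IsPrimitiveRoot ζ (dGcd (Fintype.card F) n s)) {v i : ℕ}
    (hv : v ∣ n / dGcd (Fintype.card F) n s) (hiv : i.Coprime v) :
    Irreducible (expand F v (minpoly F (ζ ^ i))) := by
  obtain ⟨a, hfin, -, hmin⟩ := exists_expand_minpoly_pow_eq_minpoly hn hs hζ hv hiv
  exact hmin ▸ minpoly.irreducible (isIntegral_of_isOfFinOrder hfin)

theorem polyOrder_expand_minpoly_pow (hn : 0 < n)
    (hs : IsBinomialExponent (Fintype.card F) n s)
    (hζ : IsPrimitiveRoot ζ (dGcd (Fintype.card F) n s)) {v i : ℕ}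
    (hv : v ∣ n / dGcd (Fintype.card F) n s) (hiv : i.Coprime v) :
    polyOrder (expand F v (minpoly F (ζ ^ i))) =
      v * (dGcd (Fintype.card F) n s / i.gcd (dGcd (Fintype.card F) n s)) := by
  obtain ⟨a, hfin, ha, hmin⟩ := exists_expand_minpoly_pow_eq_minpoly hn hs hζ hv hiv
  rw [hmin, polyOrder_minpoly hfin, ha]

theorem expand_minpoly_pow_dvd_X_pow_sub_one (hn : 0 < n)
    (hs : IsBinomialExponent (Fintype.card F) n s)
    (hζ : IsPrimitiveRoot ζ (dGcd (Fintype.card F) n s)) {v i : ℕ}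
    (hv : v ∣ n / dGcd (Fintype.card F) n s) (hiv : i.Coprime v) :
    expand F v (minpoly F (ζ ^ i)) ∣ X ^ n - 1 := by
  obtain ⟨a, -, ha, hmin⟩ := exists_expand_minpoly_pow_eq_minpoly hn hs hζ hv hiv
  have han : orderOf a ∣ n := by
    rw [ha]
    exact (mul_dvd_mul hv (Nat.div_dvd_of_dvd (Nat.gcd_dvd_right _ _))).trans
      (Nat.div_mul_cancel (dGcd_dvd _ n s)).dvd
  rw [hmin, minpoly.dvd_iff]
  simp [orderOf_dvd_iff_pow_eq_one.1 han]

theorem eq_and_eq_of_expand_minpoly_pow_eq (hn : 0 < n)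
    (hs : IsBinomialExponent (Fintype.card F) n s)
    (hζ : IsPrimitiveRoot ζ (dGcd (Fintype.card F) n s))
    {I : Finset ℕ} (hI : IsCosetRepSystem (Fintype.card F) (dGcd (Fintype.card F) n s) I)
    {v i v' i' : ℕ} (hi : i ∈ I) (hi' : i' ∈ I)
    (hv : v ∣ n / dGcd (Fintype.card F) n s) (hiv : i.Coprime v)
    (hv' : v' ∣ n / dGcd (Fintype.card F) n s) (hiv' : i'.Coprime v')
    (h : expand F v (minpoly F (ζ ^ i)) = expand F v' (minpoly F (ζ ^ i'))) :
    v = v' ∧ i = i' := by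
  have hd := dGcd_pos (q := Fintype.card F) hn s
  have horder := (polyOrder_expand_minpoly_pow hn hs hζ hv hiv).symm.trans
    ((congrArg polyOrder h).trans (polyOrder_expand_minpoly_pow hn hs hζ hv' hiv'))
  have hgcd := congrArg (Nat.gcd · (dGcd (Fintype.card F) n s)) horder
  simp only [gcd_mul_div_gcd hiv, gcd_mul_div_gcd hiv'] at hgcd
  obtain rfl : v = v' := by
    rw [hgcd] at horder
    exact Nat.eq_of_mul_eq_mul_right
      (Nat.div_pos (Nat.gcd_le_right _ hd) (Nat.gcd_pos_of_pos_right _ hd)) horder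
  have hconj : IsConjRoot F (ζ ^ i) (ζ ^ i') :=
    expand_injective (Nat.pos_of_dvd_of_pos (dvd_of_dvd_div_dGcd hv) hn) h
  exact ⟨rfl, (hI i').unique ⟨hi, (cyclotomicCoset_eq_iff_isConjRoot hd hζ).2 hconj⟩ ⟨hi', rfl⟩⟩

theorem exists_aeval_expand_minpoly_pow_eq_zero (hn : 0 < n)
    (hs : IsBinomialExponent (Fintype.card F) n s)
    (hζ : IsPrimitiveRoot ζ (dGcd (Fintype.card F) n s))
    {I : Finset ℕ} (hI : IsCosetRepSystem (Fintype.card F) (dGcd (Fintype.card F) n s) I)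
    {a : K} (ha : a ^ n = 1) :
    ∃ v, v ∣ n / dGcd (Fintype.card F) n s ∧ ∃ i ∈ I, i.Coprime v ∧
      aeval a (expand F v (minpoly F (ζ ^ i))) = 0 := by
  have hd := dGcd_pos (q := Fintype.card F) hn s
  have hdn := dGcd_dvd (Fintype.card F) n s
  have hpd (p : ℕ) (hp : p.Prime) (hpn : p ∣ n) := prime_dvd_dGcd hn hs hp hpn
  set d := dGcd (Fintype.card F) n s
  have han : orderOf a ∣ n := orderOf_dvd_of_pow_eq_one ha
  have ha0 : orderOf a ≠ 0 := (Nat.pos_of_dvd_of_pos han hn).ne'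
  have hord : orderOf (a ^ (orderOf a / (orderOf a).gcd d)) = (orderOf a).gcd d :=
    orderOf_pow_orderOf_div ha0 (Nat.gcd_dvd_left _ _)
  have hcop : (orderOf a / (orderOf a).gcd d).Coprime (d / (orderOf a).gcd d) :=
    Nat.coprime_div_gcd_div_gcd (Nat.gcd_pos_of_pos_right _ hd)
  have hv : orderOf a / (orderOf a).gcd d ∣ n / d := div_gcd_dvd_div han hdn
  set v := orderOf a / (orderOf a).gcd d
  have : NeZero d := ⟨hd.ne'⟩
  obtain ⟨j, -, hj⟩ := hζ.eq_pow_of_pow_eq_one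
    (orderOf_dvd_iff_pow_eq_one.1 (hord ▸ Nat.gcd_dvd_right (orderOf a) d))
  obtain ⟨i, ⟨hiI, hij⟩, -⟩ := hI j
  have hconj : minpoly F (ζ ^ i) = minpoly F (a ^ v) :=
    hj ▸ (cyclotomicCoset_eq_iff_isConjRoot hd hζ).1 hij
  have hgcd : i.gcd d = d / (orderOf a).gcd d := by
    have hpow (k : ℕ) : IsOfFinOrder (ζ ^ k) := (hζ.isOfFinOrder hd.ne').pow
    have h := congrArg polyOrder hconj
    rw [polyOrder_minpoly (hpow i), polyOrder_minpoly (hj ▸ hpow j), hord,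
      orderOf_pow_of_isPrimitiveRoot hd hζ] at h
    rw [← h, Nat.div_div_self (Nat.gcd_dvd_right i d) hd.ne']
  refine ⟨v, hv, i, hiI, ?_, by rw [expand_aeval, hconj, minpoly.aeval]⟩
  exact (coprime_of_coprime_gcd (fun p hp hpv ↦ hpd p hp
    (hpv.trans (hv.trans (Nat.div_dvd_of_dvd hdn)))) (hgcd ▸ hcop)).symm

theorem natCast_ne_zero_of_isPrimitiveRoot_dGcd (hn : 0 < n)
    (hs : IsBinomialExponent (Fintype.card F) n s)
    (hζ : IsPrimitiveRoot ζ (dGcd (Fintype.card F) n s)) : (n : F) ≠ 0 := by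
  intro h
  have : NeZero (dGcd (Fintype.card F) n s) := ⟨(dGcd_pos hn s).ne'⟩
  have hp : (ringChar F).Prime := CharP.char_is_prime F (ringChar F)
  have hpd := prime_dvd_dGcd hn hs hp (ringChar.dvd h)
  have : CharP K (ringChar F) := charP_of_injective_algebraMap (algebraMap F K).injective _
  exact hζ.neZero'.out ((CharP.cast_eq_zero_iff K (ringChar F) _).2 hpd)

theorem exists_expand_minpoly_pow_eq_of_irreducible_dvd (hn : 0 < n)
    (hs : IsBinomialExponent (Fintype.card F) n s)
    (hζ : IsPrimitiveRoot ζ (dGcd (Fintype.card F) n s))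
    {I : Finset ℕ} (hI : IsCosetRepSystem (Fintype.card F) (dGcd (Fintype.card F) n s) I)
    {g : F[X]} (hmonic : g.Monic) (hirr : Irreducible g) (hdvd : g ∣ X ^ n - 1) :
    ∃ v, v ∣ n / dGcd (Fintype.card F) n s ∧ ∃ i ∈ I, i.Coprime v ∧
      expand F v (minpoly F (ζ ^ i)) = g := by
  have hinj := (algebraMap K (AlgebraicClosure K)).injective
  obtain ⟨a, ha⟩ := IsAlgClosed.exists_aeval_eq_zero (AlgebraicClosure K) g hirr.degree_pos.ne'
  have han : a ^ n = 1 := by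
    simpa [sub_eq_zero] using aeval_eq_zero_of_dvd_aeval_eq_zero hdvd ha
  obtain ⟨v, hv, i, hi, hiv, hroot⟩ :=
    exists_aeval_expand_minpoly_pow_eq_zero hn hs (hζ.map_of_injective hinj) hI han
  rw [← map_pow, minpoly.algebraMap_eq hinj] at hroot
  have hdvd' : g ∣ expand F v (minpoly F (ζ ^ i)) := by
    rw [minpoly.eq_of_irreducible_of_monic hirr ha hmonic]
    exact minpoly.dvd F a hroot
  have hmonic' : (expand F v (minpoly F (ζ ^ i))).Monic :=
    (minpoly.monic (isIntegral_of_isOfFinOrder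
      (hζ.isOfFinOrder (dGcd_pos hn s).ne').pow)).expand
      (Nat.pos_of_dvd_of_pos (dvd_of_dvd_div_dGcd hv) hn)
  exact ⟨v, hv, i, hi, hiv, (eq_of_monic_of_associated hmonic hmonic'
    (hirr.associated_of_dvd (irreducible_expand_minpoly_pow hn hs hζ hv hiv) hdvd')).symm⟩

theorem X_pow_sub_one_eq_prod_expand_minpoly_pow (hn : 0 < n)
    (hs : IsBinomialExponent (Fintype.card F) n s)
    (hζ : IsPrimitiveRoot ζ (dGcd (Fintype.card F) n s))
    {I : Finset ℕ} (hI : IsCosetRepSystem (Fintype.card F) (dGcd (Fintype.card F) n s) I) :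
    (X ^ n - 1 : F[X]) = ∏ v ∈ (n / dGcd (Fintype.card F) n s).divisors,
      ∏ i ∈ I with i.Coprime v, expand F v (minpoly F (ζ ^ i)) := by
  have hd := dGcd_pos (q := Fintype.card F) hn s
  have hquot : n / dGcd (Fintype.card F) n s ≠ 0 :=
    (Nat.div_pos (Nat.le_of_dvd hn (dGcd_dvd _ n s)) hd).ne'
  have hsq : Squarefree (X ^ n - 1 : F[X]) := (X_pow_sub_one_separable_iff.2
    (natCast_ne_zero_of_isPrimitiveRoot_dGcd hn hs hζ)).squarefree
  rw [Finset.prod_sigma']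
  refine eq_prod_of_forall_irreducible_dvd (monic_X_pow_sub_C 1 hn.ne') hsq ?_ ?_ ?_
  · rintro ⟨v, i⟩ hvi ⟨v', i'⟩ hvi' h
    simp only [Finset.coe_sigma, Set.mem_sigma_iff, Finset.mem_coe, Nat.mem_divisors,
      Finset.mem_filter] at hvi hvi'
    obtain ⟨rfl, rfl⟩ := eq_and_eq_of_expand_minpoly_pow_eq hn hs hζ hI hvi.2.1 hvi'.2.1
      hvi.1.1 hvi.2.2 hvi'.1.1 hvi'.2.2 h
    rfl
  · rintro ⟨v, i⟩ hvi
    simp only [Finset.mem_sigma, Nat.mem_divisors, Finset.mem_filter] at hvi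
    obtain ⟨⟨hv, -⟩, -, hiv⟩ := hvi
    exact ⟨(minpoly.monic (isIntegral_of_isOfFinOrder (hζ.isOfFinOrder hd.ne').pow)).expand
        (Nat.pos_of_dvd_of_pos hv (Nat.pos_of_ne_zero hquot)),
      irreducible_expand_minpoly_pow hn hs hζ hv hiv,
      expand_minpoly_pow_dvd_X_pow_sub_one hn hs hζ hv hiv⟩
  · intro g hmonic hirr hdvd
    obtain ⟨v, hv, i, hi, hiv, rfl⟩ :=
      exists_expand_minpoly_pow_eq_of_irreducible_dvd hn hs hζ hI hmonic hirr hdvd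
    exact ⟨⟨v, i⟩, Finset.mem_sigma.2
      ⟨Nat.mem_divisors.2 ⟨hv, hquot⟩, Finset.mem_filter.2 ⟨hi, hiv⟩⟩, rfl⟩

end Factors

theorem radical_dvd_pow_extDeg_sub_one {q : ℕ} (hq : 0 < q) (n : ℕ) :
    UniqueFactorizationMonoid.radical n ∣ q ^ extDeg q n - 1 := by
  have hw : ordRad q n ∣ extDeg q n := by
    unfold extDeg
    split_ifs
    exacts [dvd_rfl, dvd_mul_left _ _]
  refine (Nat.modEq_iff_dvd' (Nat.one_le_pow _ _ hq)).1 ?_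
  rw [← ZMod.natCast_eq_natCast_iff, Nat.cast_pow, Nat.cast_one]
  exact (orderOf_dvd_iff_pow_eq_one.1 hw).symm

theorem four_dvd_pow_extDeg_sub_one {q n : ℕ} (hnq : n.Coprime q) (h : 4 ∣ n) :
    4 ∣ q ^ extDeg q n - 1 := by
  have hodd : Odd q := (Nat.Coprime.coprime_dvd_left
    (Dvd.dvd.trans ⟨2, rfl⟩ h) hnq).symm.odd_of_right
  unfold extDeg
  split_ifs with hc
  · exact (Nat.modEq_iff_dvd' hodd.pow.pos).1 (hc.resolve_left (not_not.2 h)).symm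
  · rw [mul_comm, pow_mul]
    exact Dvd.dvd.trans ⟨2, rfl⟩ (Nat.eight_dvd_sq_sub_one_of_odd hodd.pow)

theorem isBinomialExponent_extDeg {q n : ℕ} (hq : 0 < q) (hnq : n.Coprime q) :
    IsBinomialExponent q n (extDeg q n) where
  radical_dvd := radical_dvd_pow_extDeg_sub_one hq n
  four_dvd h := four_dvd_pow_extDeg_sub_one hnq (Dvd.dvd.trans ⟨2, rfl⟩ h)

theorem theorem2p5_general {F K : Type*} [Field F] [Fintype F] [Field K] [Algebra F K]
    (q n s : ℕ) (hq : Fintype.card F = q) (hn : 0 < n) (hs : IsBinomialExponent q n s)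
    (ζ : K) (hζ : IsPrimitiveRoot ζ (dGcd q n s))
    (I : Finset ℕ) (hI : IsCosetRepSystem q (dGcd q n s) I) :
    ∃ S : ℕ → ℕ → F[X],
      ((X ^ n - 1 : F[X]) =
        ∏ v ∈ (n / dGcd q n s).divisors, ∏ i ∈ I with Nat.gcd i v = 1, S v i) ∧
      ∀ v ∈ (n / dGcd q n s).divisors, ∀ i ∈ I, Nat.gcd i v = 1 →
        (S v i).map (algebraMap F K) = closedFactor q ζ (cosetDeg q n s i) v i ∧
        (S v i).map (algebraMap F K) =
          ∏ u ∈ Finset.range (cosetDeg q n s i), (X ^ v - C (ζ ^ (i * q ^ u))) ∧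
        (S v i).Monic ∧
        Irreducible (S v i) ∧
        (S v i).natDegree = v * cosetDeg q n s i ∧
        polyOrder (S v i) = v * (dGcd q n s / Nat.gcd i (dGcd q n s)) := by
  subst hq
  have hint (i : ℕ) : IsIntegral F (ζ ^ i) :=
    isIntegral_of_isOfFinOrder (hζ.isOfFinOrder (dGcd_pos hn s).ne').pow
  refine ⟨fun v i ↦ expand F v (minpoly F (ζ ^ i)),
    X_pow_sub_one_eq_prod_expand_minpoly_pow hn hs hζ hI, fun v hv i _ hiv ↦ ?_⟩
  have hv0 := Nat.pos_of_mem_divisors hv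
  have hv := Nat.dvd_of_mem_divisors hv
  have hmap := map_expand_minpoly (hint i) v
  simp only [← pow_mul] at hmap
  rw [closedFactor_eq_prod, cosetDeg_eq_natDegree_minpoly hn hζ]
  exact ⟨hmap, hmap, (minpoly.monic (hint i)).expand hv0,
    irreducible_expand_minpoly_pow hn hs hζ hv hiv,
    (natDegree_expand _ _).trans (mul_comm _ _),
    polyOrder_expand_minpoly_pow hn hs hζ hv hiv⟩

theorem theorem2p5 {F K : Type*} [Field F] [Fintype F] [Field K] [Algebra F K]
    (q n : ℕ) (hq : Fintype.card F = q) (hn : 0 < n) (hnq : Nat.gcd n q = 1)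
    (ζ : K) (hζ : IsPrimitiveRoot ζ (dGcd q n (extDeg q n)))
    (I : Finset ℕ) (hI : IsCosetRepSystem q (dGcd q n (extDeg q n)) I) :
    ∃ S : ℕ → ℕ → F[X],
      ((X ^ n - 1 : F[X]) =
        ∏ v ∈ (n / dGcd q n (extDeg q n)).divisors,
          ∏ i ∈ I with Nat.gcd i v = 1, S v i) ∧
      ∀ v ∈ (n / dGcd q n (extDeg q n)).divisors, ∀ i ∈ I, Nat.gcd i v = 1 →
        (S v i).map (algebraMap F K) = closedFactor q ζ (coeffDeg q n i) v i ∧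
        (S v i).map (algebraMap F K) =
          ∏ u ∈ Finset.range (coeffDeg q n i), (X ^ v - C (ζ ^ (i * q ^ u))) ∧
        (S v i).Monic ∧
        Irreducible (S v i) ∧
        (S v i).natDegree = v * coeffDeg q n i ∧
        polyOrder (S v i) =
          v * (dGcd q n (extDeg q n) / Nat.gcd i (dGcd q n (extDeg q n))) :=
  theorem2p5_general q n (extDeg q n) hq hn
    (isBinomialExponent_extDeg (hq ▸ Fintype.card_pos) hnq) ζ hζ I hI
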